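/- Let $M$ be a connected, Hausdorff, paracompact smooth manifold modelled on a separable real Hilbert space $\mathbb{H}$, equipped with a strong symplectic form $\omega$, i.e. a smooth closed $2$-form such that for every $x \in M$ the map $T_xM \to (T_xM)^*$, $v \mapsto \omega_x(v,\cdot)$, is bijective. Let $\mathbb{R}^n$ act on $M$, and suppose that the action is almost periodic: for some $N$ it is the composition of a continuous homomorphism $\mathbb{R}^n \to (S^1)^N$ with a smooth action of the torus $(S^1)^N$ on $M$. Suppose that the fixed points of the $\mathbb{R}^n$-action are isolated. Let $\mu \colon M \to \mathbb{R}^n$ be a momentum map for the action, i.e. a smooth map such that for every $\xi \in \mathbb{R}^n$ the function $\mu^\xi = \langle \mu(\cdot), \xi\rangle$ satisfies $d\mu^\xi = \omega(\xi_M, \cdot)$, where $\xi_M(x) = \frac{d}{dt}\big|_{t=0} (t\xi)\cdot x$. Call $x \in M$ a regular point of $\mu$ if $d\mu_x \colon T_xM \to \mathbb{R}^n$ is surjective, call $c \in \mathbb{R}^n$ a singular value of $\mu$ if $c = \mu(x)$ for some $x$ that is not a regular point, and a regular value otherwise. Then the set of singular values of $\mu$ is contained in a countable union of affine hyperplanes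 (affine subspaces of codimension one) of $\mathbb{R}^n$. In particular, the set of regular values of $\mu$ is residual in $\mathbb{R}^n$ (its complement is a countable union of nowhere dense sets). -/

import Mathlib

open Set Filter Topology
open scoped Manifold ContDiff

noncomputable section

namespace AlmostPeriodic

section Symplectic

variable (H : Type*) [NormedAddCommGroup H] [InnerProductSpace ℝ H] [CompleteSpace H]
variable (M : Type*) [TopologicalSpace M] [ChartedSpace H M] [IsManifold 𝓘(ℝ, H) ∞ M]

variable {H M} in
/-- The coordinate expression, on the target of a chart `e`, of a field `σ` of bilinear forms on
the tangent spaces: the pullback `(e⁻¹)^* σ`. -/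
def localForm
    (σ : ∀ x : M, TangentSpace 𝓘(ℝ, H) x →L[ℝ] TangentSpace 𝓘(ℝ, H) x →L[ℝ] ℝ)
    (e : OpenPartialHomeomorph M H) (y : H) : H →L[ℝ] H →L[ℝ] ℝ :=
  let B : H →L[ℝ] H →L[ℝ] ℝ := σ (e.symm y)
  let A : H →L[ℝ] H := mfderiv 𝓘(ℝ, H) 𝓘(ℝ, H) e.symm y
  B.bilinearComp A A

/-- A strong symplectic form on a manifold modelled on the Hilbert space `H`: a smooth closed
differential 2-form `σ` such that `v ↦ σ_x(v, ·)` is a bijection from `T_x M` onto its continuous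
dual, for every `x`. -/
structure StrongSymplecticForm where
  /-- The bilinear form on each tangent space. -/
  form (x : M) : TangentSpace 𝓘(ℝ, H) x →L[ℝ] TangentSpace 𝓘(ℝ, H) x →L[ℝ] ℝ
  /-- The form is alternating. -/
  alternating (x : M) (v : TangentSpace 𝓘(ℝ, H) x) : form x v v = 0
  /-- The form is a smooth section of the bundle of continuous bilinear forms. -/
  smooth : ContMDiff 𝓘(ℝ, H) (𝓘(ℝ, H).prod 𝓘(ℝ, H →L[ℝ] H →L[ℝ] ℝ)) ∞
    (fun x : M ↦ Bundle.TotalSpace.mk' (H →L[ℝ] H →L[ℝ] ℝ)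
      (E := fun x : M ↦ TangentSpace 𝓘(ℝ, H) x →L[ℝ] TangentSpace 𝓘(ℝ, H) x →L[ℝ] ℝ)
      x (form x))
  /-- The exterior derivative vanishes: in each chart `e`,
  `dσ(u, v, w) = D_u σ(v, w) - D_v σ(u, w) + D_w σ(u, v) = 0`. -/
  closed : ∀ e ∈ atlas H M, ∀ y ∈ e.target, ∀ u v w : H,
    fderiv ℝ (localForm form e) y u v w - fderiv ℝ (localForm form e) y v u w
      + fderiv ℝ (localForm form e) y w u v = 0
  /-- Strong nondegeneracy. -/
  nondegenerate (x : M) : Function.Bijective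
    (fun v : TangentSpace 𝓘(ℝ, H) x ↦ form x v)

end Symplectic

section Actions

variable {H : Type*} [NormedAddCommGroup H] [InnerProductSpace ℝ H]
variable {M : Type*} [TopologicalSpace M] [ChartedSpace H M]

variable (H M) in
/-- An action of `ℝⁿ` on `M` is almost periodic if it is the composition of a continuous
homomorphism from `ℝⁿ` to a torus `(S¹)ᴺ` with a smooth action of this torus on `M`. -/
def IsAlmostPeriodic (n : ℕ) [AddAction (EuclideanSpace ℝ (Fin n)) M] : Prop :=
  ∃ (N : ℕ) (_ : MulAction (Fin N → Circle) M)
    (φ : Multiplicative (EuclideanSpace ℝ (Fin n)) →ₜ* (Fin N → Circle)),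
    ContMDiff ((ModelWithCorners.pi fun _ : Fin N ↦ 𝓡 1).prod 𝓘(ℝ, H)) 𝓘(ℝ, H) ∞
      (fun p : (Fin N → Circle) × M ↦ p.1 • p.2) ∧
    ∀ (s : EuclideanSpace ℝ (Fin n)) (x : M), s +ᵥ x = φ (Multiplicative.ofAdd s) • x

variable (M) in
/-- The action has isolated fixed points: its fixed point set is discrete. -/
def HasIsolatedFixedPoints (n : ℕ) [AddAction (EuclideanSpace ℝ (Fin n)) M] : Prop :=
  ∀ x ∈ AddAction.fixedPoints (EuclideanSpace ℝ (Fin n)) M,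
    ∃ U ∈ 𝓝 x, U ∩ AddAction.fixedPoints (EuclideanSpace ℝ (Fin n)) M = {x}

variable (H) in
/-- The vector field on `M` generated by `ξ ∈ ℝⁿ`: its value at `x` is the velocity at `t = 0` of
the curve `t ↦ (t ξ) · x`. -/
def generator {n : ℕ} [AddAction (EuclideanSpace ℝ (Fin n)) M]
    (ξ : EuclideanSpace ℝ (Fin n)) (x : M) : TangentSpace 𝓘(ℝ, H) x :=
  (mfderiv 𝓘(ℝ, ℝ) 𝓘(ℝ, H) (fun t : ℝ ↦ (t • ξ) +ᵥ x) 0 : ℝ →L[ℝ] H) (1 : ℝ)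

/-- `μ : M → ℝⁿ` is a momentum map of the `ℝⁿ`-action with respect to `σ`: it is smooth and each
component `μ^ξ = ⟨μ, ξ⟩` satisfies `dμ^ξ = σ(ξ_M, ·)`, where `ξ_M` is the vector field generated
by `ξ`. -/
structure IsMomentumMap [CompleteSpace H] [IsManifold 𝓘(ℝ, H) ∞ M]
    (σ : StrongSymplecticForm H M) {n : ℕ} [AddAction (EuclideanSpace ℝ (Fin n)) M]
    (μ : M → EuclideanSpace ℝ (Fin n)) : Prop where
  smooth : ContMDiff 𝓘(ℝ, H) 𝓘(ℝ, EuclideanSpace ℝ (Fin n)) ∞ μ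
  hamilton : ∀ (ξ : EuclideanSpace ℝ (Fin n)) (x : M) (v : TangentSpace 𝓘(ℝ, H) x),
    mvfderiv 𝓘(ℝ, H) (fun y : M ↦ inner ℝ (μ y) ξ) x v = σ.form x (generator H ξ x) v

variable (H) in
/-- `x` is a regular point of `F : M → ℝⁿ` if `dF_x` is surjective. -/
def IsRegularPoint {n : ℕ} (F : M → EuclideanSpace ℝ (Fin n)) (x : M) : Prop :=
  Function.Surjective (mvfderiv 𝓘(ℝ, H) F x)

variable (H) in
/-- The singular values of `F`: the values taken at some point that is not regular. -/
def singularValues {n : ℕ} (F : M → EuclideanSpace ℝ (Fin n)) :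
    Set (EuclideanSpace ℝ (Fin n)) :=
  {c | ∃ x, F x = c ∧ ¬ IsRegularPoint H F x}

variable (H) in
/-- The regular values of `F`: the points of `ℝⁿ` over which every point is regular. -/
def regularValues {n : ℕ} (F : M → EuclideanSpace ℝ (Fin n)) :
    Set (EuclideanSpace ℝ (Fin n)) :=
  {c | ∀ x, F x = c → IsRegularPoint H F x}

end Actions

/-- An affine hyperplane of `ℝⁿ`: a nonempty affine subspace of codimension one. -/
def IsAffineHyperplane {n : ℕ} (A : AffineSubspace ℝ (EuclideanSpace ℝ (Fin n))) : Prop :=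
  (A : Set (EuclideanSpace ℝ (Fin n))).Nonempty ∧ Module.finrank ℝ A.direction + 1 = n

end AlmostPeriodic

end

/-! At a singular point `x` some nonzero `η` is orthogonal to the range of `dμ_x`, so `ω(η_M, ·)`
vanishes at `x`. Nondegeneracy gives `η_M(x) = 0`, hence the Lie algebra of the stabilizer of `x` is
nonzero. Only countably many such algebras occur: they are upper semicontinuous in `x`
(`eventually_stabilizerAlgebra_le`) and `M` is second countable. Choose one nonzero `ξ` in each
nonzero algebra. Every singular point is then fixed by the one-parameter group of one of these
countably many `ξ`. On the set fixed by `ξ` the function `⟨ξ, μ⟩` is critical. Almost periodicity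
makes this set the fixed point set of a compact group, near each point of which the action can be
linearized by averaging. A critical function is therefore locally constant along it and takes
countably many values `c` there (`countable_image_setOf_mem_stabilizerAlgebra`). The hyperplanes
`⟨ξ, ·⟩ = c` contain all singular values. -/

noncomputable section

namespace AlmostPeriodic

/-! ### Second countability and countability of values. -/

section Topology

/-- Each `v j` that meets `s` contains a point of a countable dense subset of `s`, and each such
point lies in only finitely many `v j`. -/
theorem countable_setOf_inter_nonempty {X ι : Type*} [TopologicalSpace X] {v : ι → Set X}
    (hv : LocallyFinite v) (ho : ∀ i, IsOpen (v i)) (s : Set X) [TopologicalSpace.SeparableSpace s] :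
    {j | (v j ∩ s).Nonempty}.Countable := by
  obtain ⟨D, hDc, hDd⟩ := TopologicalSpace.exists_countable_dense s
  refine (hDc.biUnion fun d _ ↦ (hv.point_finite (d : X)).countable).mono ?_
  rintro j ⟨p, hpj, hps⟩
  obtain ⟨d, hd, hdj⟩ := hDd.exists_mem_open ((ho j).preimage continuous_subtype_val)
    ⟨⟨p, hps⟩, hpj⟩
  exact mem_biUnion hd hdj

theorem countable_setOf_reflTransGen {ι : Type*} {r : ι → ι → Prop}
    (hr : ∀ i, {j | r i j}.Countable) (i : ι) : {j | Relation.ReflTransGen r i j}.Countable := by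
  let S : ℕ → Set ι := fun k ↦ Nat.rec {i} (fun _ T ↦ ⋃ a ∈ T, {j | r a j}) k
  have hS : ∀ k, (S k).Countable := by
    intro k
    induction k with
    | zero => exact countable_singleton i
    | succ k ih => exact ih.biUnion fun a _ ↦ hr a
  refine (countable_iUnion hS).mono fun j hj ↦ ?_
  induction hj with
  | refl => exact mem_iUnion.2 ⟨0, rfl⟩
  | tail _ hbc ih =>
    obtain ⟨k, hk⟩ := mem_iUnion.1 ih
    exact mem_iUnion.2 ⟨k + 1, mem_biUnion hk hbc⟩

/-- A connected paracompact space that is locally homeomorphic to a second countable space is second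
countable. -/
theorem secondCountableTopology_of_paracompact (H : Type*) {M : Type*} [TopologicalSpace H]
    [SecondCountableTopology H] [TopologicalSpace M] [ChartedSpace H M] [ParacompactSpace M]
    [ConnectedSpace M] : SecondCountableTopology M := by
  obtain ⟨v, hvo, hvu, hvf, hvs⟩ := precise_refinement (fun x : M ↦ (chartAt H x).source)
    (fun x ↦ (chartAt H x).open_source)
    (eq_univ_of_forall fun x ↦ mem_iUnion.2 ⟨x, mem_chart_source H x⟩)
  let r : M → M → Prop := fun i j ↦ (v j ∩ v i).Nonempty
  have hr : ∀ i, {j | r i j}.Countable := by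
    intro i
    have : SecondCountableTopology (chartAt H i).source :=
      (chartAt H i).secondCountableTopology_source
    exact (countable_setOf_inter_nonempty hvf hvo (chartAt H i).source).mono
      fun j hj ↦ hj.mono (inter_subset_inter_right _ (hvs i))
  obtain ⟨i₀, hi₀⟩ : ∃ i, (v i).Nonempty := by
    obtain ⟨x⟩ := (inferInstance : Nonempty M)
    obtain ⟨i, hi⟩ := mem_iUnion.1 (hvu ▸ mem_univ x : x ∈ ⋃ i, v i)
    exact ⟨i, x, hi⟩
  let J := {j | Relation.ReflTransGen r i₀ j}
  have hJ : J.Countable := countable_setOf_reflTransGen hr i₀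
  -- A member of the cover that meets some `v j` with `j ∈ J` again has its index in `J`; the
  -- complement is thus the union of the other members.
  have hclopen : IsClopen (⋃ j ∈ J, v j) := by
    refine ⟨⟨?_⟩, isOpen_biUnion fun j _ ↦ hvo j⟩
    have : (⋃ j ∈ J, v j)ᶜ = ⋃ j ∈ Jᶜ, v j := by
      ext p
      simp only [mem_compl_iff, mem_iUnion, not_exists]
      constructor
      · intro h
        obtain ⟨j, hj⟩ := mem_iUnion.1 (hvu ▸ mem_univ p : p ∈ ⋃ i, v i)
        exact ⟨j, fun hjJ ↦ h j hjJ hj, hj⟩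
      · rintro ⟨j, hj, hpj⟩ i hi hpi
        exact hj (Relation.ReflTransGen.tail hi ⟨p, hpj, hpi⟩)
    rw [this]
    exact isOpen_biUnion fun j _ ↦ hvo j
  have hne : (⋃ j ∈ J, v j).Nonempty :=
    hi₀.mono (subset_biUnion_of_mem (u := v) (Relation.ReflTransGen.refl : i₀ ∈ J))
  refine ChartedSpace.secondCountable_of_countable_cover H (s := J) ?_ hJ
  exact eq_univ_of_subset (iUnion₂_mono fun j _ ↦ hvs j) (hclopen.eq_univ hne)

/-- A function that is locally constant along a subset of a second countable space takes countably
many values on it. -/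
theorem countable_image_of_eventually_eq {X Y : Type*} [TopologicalSpace X]
    [SecondCountableTopology X] {f : X → Y} {s : Set X}
    (h : ∀ x ∈ s, ∀ᶠ y in 𝓝 x, y ∈ s → f y = f x) : (f '' s).Countable := by
  obtain ⟨t, hts, htc, ht⟩ := TopologicalSpace.countable_cover_nhdsWithin
    (s := s) (f := fun x ↦ {y | y ∈ s → f y = f x}) fun x hx ↦ mem_nhdsWithin_of_mem_nhds (h x hx)
  refine (htc.image f).mono ?_
  rintro _ ⟨x, hx, rfl⟩
  obtain ⟨y, hy, hxy⟩ := mem_iUnion₂.1 (ht hx)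
  exact ⟨y, hy, (hxy hx).symm⟩

/-- An upper semicontinuous map from a second countable space to a partial order has countable
range. -/
theorem countable_range_of_eventually_le {X P : Type*} [TopologicalSpace X]
    [SecondCountableTopology X] [PartialOrder P] {f : X → P}
    (h : ∀ x, ∀ᶠ y in 𝓝 x, f y ≤ f x) : (range f).Countable := by
  have hb := TopologicalSpace.isBasis_countableBasis X
  choose B hB hxB hBs using fun x ↦ hb.mem_nhds_iff.1 (h x)
  -- `f x` is the maximum of `f` on `B x`, so the basic open set determines the value.
  have hinj : ∀ x y, B x = B y → f x = f y := fun x y hxy ↦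
    le_antisymm (hBs y (hxy ▸ hxB x)) (hBs x (hxy ▸ hxB y))
  have hc : (range B).Countable :=
    (TopologicalSpace.countable_countableBasis X).mono (range_subset_iff.2 hB)
  choose g hg using fun b : range B ↦ b.2
  have := hc.to_subtype
  refine (countable_range fun b : range B ↦ f (g b)).mono ?_
  rintro _ ⟨x, rfl⟩
  exact ⟨⟨B x, x, rfl⟩, hinj _ _ (hg ⟨B x, x, rfl⟩)⟩

end Topology

/-! ### Lifting characters to linear forms. -/

section CircleHom

/-- A continuous homomorphism from a real topological vector space to the circle is the exponential
of a continuous linear form. -/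
theorem exists_circleExp_eq {V : Type*} [NormedAddCommGroup V] [NormedSpace ℝ V]
    (φ : Multiplicative V →ₜ* Circle) :
    ∃ a : V →L[ℝ] ℝ, ∀ s, φ (Multiplicative.ofAdd s) = Circle.exp (a s) := by
  have hφ : Continuous fun s : V ↦ φ (Multiplicative.ofAdd s) :=
    φ.continuous_toFun.comp continuous_ofAdd
  have hc := Circle.isCoveringMap_exp
  have : SimplyConnectedSpace V := inferInstance
  obtain ⟨F, ⟨hF0, hF⟩, -⟩ := hc.existsUnique_continuousMap_lifts
    ⟨fun s : V ↦ φ (Multiplicative.ofAdd s), hφ⟩ (a₀ := 0) (e₀ := 0) (by simp)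
  have hFs : ∀ s, Circle.exp (F s) = φ (Multiplicative.ofAdd s) := fun s ↦ congrFun hF s
  -- Both sides lift the same map on the connected space `V × V` and agree at the origin.
  have hadd : ∀ s t, F (s + t) = F s + F t := by
    have := hc.eq_of_comp_eq (A := V × V) (g₁ := fun p ↦ F (p.1 + p.2))
      (g₂ := fun p ↦ F p.1 + F p.2) (by fun_prop) (by fun_prop)
      (by ext1 p; simp [hFs, Circle.exp_add]) (0, 0) (by simp [hF0])
    exact fun s t ↦ congrFun this (s, t)
  exact ⟨(AddMonoidHom.mk' F hadd).toRealLinearMap F.continuous, fun s ↦ (hFs s).symm⟩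

end CircleHom

/-! ### Exponential coordinates on the torus. -/

section Torus

/-- The exponential map of the torus `(S¹)ᴺ`. -/
def torusExp {N : ℕ} (s : Fin N → ℝ) : Fin N → Circle := fun i ↦ Circle.exp (s i)

theorem torusExp_zero {N : ℕ} : torusExp (0 : Fin N → ℝ) = 1 := by
  ext i; simp [torusExp]

theorem contMDiff_torusExp {N : ℕ} :
    ContMDiff 𝓘(ℝ, Fin N → ℝ) (ModelWithCorners.pi fun _ : Fin N ↦ 𝓡 1) ∞
      (torusExp : (Fin N → ℝ) → (Fin N → Circle)) := by
  have hcoord : ∀ i : Fin N, ContMDiff 𝓘(ℝ, Fin N → ℝ) (𝓡 1) ∞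
      (fun s : Fin N → ℝ ↦ Circle.exp (s i)) := fun i ↦
    contMDiff_circleExp.comp (contDiff_apply ℝ ℝ i).contMDiff
  intro s
  rw [contMDiffAt_iff]
  refine ⟨(continuous_pi fun i ↦ (hcoord i).continuous).continuousAt, ?_⟩
  rw [contDiffWithinAt_pi]
  exact fun i ↦ (contMDiffAt_iff.1 (hcoord i s)).2

/-- The exponential map of the torus has a section that is continuous at a given point. -/
theorem exists_torusExp_section {N : ℕ} (s : Fin N → ℝ) :
    ∃ l : (Fin N → Circle) → (Fin N → ℝ), (∀ g, torusExp (l g) = g) ∧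
      Tendsto l (𝓝 (torusExp s)) (𝓝 s) := by
  refine ⟨fun g i ↦ s i + Complex.arg ((g i / Circle.exp (s i) : Circle) : ℂ), fun g ↦ ?_, ?_⟩
  · ext1 i
    simp only [torusExp, Circle.exp_add, Circle.exp_arg, mul_div_cancel]
  · rw [tendsto_pi_nhds]
    intro i
    have h1 : ContinuousAt (fun g : Fin N → Circle ↦
        Complex.arg ((g i / Circle.exp (s i) : Circle) : ℂ)) (torusExp s) := by
      refine ContinuousAt.comp (g := Complex.arg)
        (f := fun g : Fin N → Circle ↦ ((g i / Circle.exp (s i) : Circle) : ℂ)) ?_ ?_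
      · refine Complex.continuousAt_arg ?_
        simp [torusExp]
      · exact Continuous.continuousAt (by fun_prop)
    have h2 := (tendsto_const_nhds (x := s i)).add h1.tendsto
    simpa [torusExp] using h2

theorem torusExp_surjective {N : ℕ} : Function.Surjective (torusExp (N := N)) := fun g ↦ by
  obtain ⟨l, hl, -⟩ := exists_torusExp_section (0 : Fin N → ℝ)
  exact ⟨l g, hl g⟩

/-- Lets limits computed in the Lie algebra descend to the torus. -/
theorem nhds_torusExp_le_map {N : ℕ} (s : Fin N → ℝ) : 𝓝 (torusExp s) ≤ map torusExp (𝓝 s) := by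
  obtain ⟨l, hl, hlt⟩ := exists_torusExp_section s
  calc 𝓝 (torusExp s) = map torusExp (map l (𝓝 (torusExp s))) := by
        rw [map_map, show torusExp ∘ l = id from funext hl, map_id]
    _ ≤ map torusExp (𝓝 s) := map_mono hlt

variable {H : Type*} [NormedAddCommGroup H] [InnerProductSpace ℝ H]
  {M : Type*} [TopologicalSpace M] [ChartedSpace H M]

theorem contMDiff_torusExp_smul {N : ℕ} [MulAction (Fin N → Circle) M]
    (h : ContMDiff ((ModelWithCorners.pi fun _ : Fin N ↦ 𝓡 1).prod 𝓘(ℝ, H)) 𝓘(ℝ, H) ∞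
      (fun p : (Fin N → Circle) × M ↦ p.1 • p.2)) :
    ContMDiff (𝓘(ℝ, Fin N → ℝ).prod 𝓘(ℝ, H)) 𝓘(ℝ, H) ∞
      (fun p : (Fin N → ℝ) × M ↦ torusExp p.1 • p.2) :=
  h.comp ((contMDiff_torusExp.comp contMDiff_fst).prodMk contMDiff_snd)

/-- An almost periodic action is given by a linear map from `ℝⁿ` to the Lie algebra of a torus acting
smoothly. -/
theorem IsAlmostPeriodic.exists_linear {n : ℕ} [AddAction (EuclideanSpace ℝ (Fin n)) M]
    (h : IsAlmostPeriodic H M n) :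
    ∃ (N : ℕ) (_ : MulAction (Fin N → Circle) M) (a : EuclideanSpace ℝ (Fin n) →L[ℝ] (Fin N → ℝ)),
      ContMDiff ((ModelWithCorners.pi fun _ : Fin N ↦ 𝓡 1).prod 𝓘(ℝ, H)) 𝓘(ℝ, H) ∞
        (fun p : (Fin N → Circle) × M ↦ p.1 • p.2) ∧
      ∀ (s : EuclideanSpace ℝ (Fin n)) (x : M), s +ᵥ x = torusExp (a s) • x := by
  obtain ⟨N, _, φ, hsm, hφ⟩ := h
  have hcomp : ∀ i : Fin N, ∃ a : EuclideanSpace ℝ (Fin n) →L[ℝ] ℝ,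
      ∀ s, φ (Multiplicative.ofAdd s) i = Circle.exp (a s) := fun i ↦
    exists_circleExp_eq
      ⟨(Pi.evalMonoidHom _ i).comp φ.toMonoidHom, (continuous_apply i).comp φ.continuous_toFun⟩
  choose a ha using hcomp
  refine ⟨N, _, ContinuousLinearMap.pi a, hsm, fun s x ↦ ?_⟩
  rw [hφ]
  congr 1
  ext1 i
  exact ha i s

end Torus

/-! ### Averaging near a fixed point of a compact group. -/

section Linearization

open MeasureTheory

variable {H : Type*} [NormedAddCommGroup H] [NormedSpace ℝ H]

/-- If `ψ` is close to the identity on a neighbourhood of `p`, the segments issuing from `ψ p` lift to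
Lipschitz curves; a function whose derivative vanishes along these lifts is constant on them. -/
theorem eq_of_hasFDerivAt_zero_of_approximatesLinearOn {ψ : H → H} {U : Set H}
    (hψ : ApproximatesLinearOn ψ (ContinuousLinearMap.id ℝ H) U (1 / 2)) {p q : H} (hp : p ∈ U)
    (hq : q ∈ U) {F : H → ℝ}
    (hF : ∀ t ∈ Icc (0 : ℝ) 1, ∃ c ∈ U, ψ c = ψ p + t • (ψ q - ψ p) ∧ HasFDerivAt F (0 : H →L[ℝ] ℝ) c) :
    F q = F p := by
  have hanti : ∀ u ∈ U, ∀ v ∈ U, ‖u - v‖ ≤ 2 * ‖ψ u - ψ v‖ := by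
    intro u hu v hv
    have h1 := hψ u hu v hv
    have h2 : ‖u - v‖ ≤ ‖ψ u - ψ v‖ + ‖ψ u - ψ v - (u - v)‖ := by
      rw [show u - v = (ψ u - ψ v) - (ψ u - ψ v - (u - v)) by abel]
      refine (norm_sub_le _ _).trans_eq ?_
      simp
    simp only [ContinuousLinearMap.id_apply] at h1
    have h3 : (((1 / 2 : NNReal)) : ℝ) = 1 / 2 := by norm_num
    rw [h3] at h1
    linarith
  have hinj : ∀ u ∈ U, ∀ v ∈ U, ψ u = ψ v → u = v := by
    intro u hu v hv h
    have := hanti u hu v hv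
    rw [h, sub_self, norm_zero, mul_zero] at this
    exact sub_eq_zero.1 (norm_le_zero_iff.1 this)
  choose! c hcU hcψ hcF using hF
  have hlip : ∀ t ∈ Icc (0 : ℝ) 1, ∀ t' ∈ Icc (0 : ℝ) 1,
      ‖c t' - c t‖ ≤ (2 * ‖ψ q - ψ p‖) * ‖t' - t‖ := by
    intro t ht t' ht'
    refine (hanti _ (hcU t' ht') _ (hcU t ht)).trans_eq ?_
    rw [hcψ t ht, hcψ t' ht', add_sub_add_left_eq_sub, ← sub_smul, norm_smul]
    ring
  -- `c` is only Lipschitz, but a zero derivative of `F` at `c t` gives `F (c t') - F (c t) = o(c t'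
  -- - c t) = o(t' - t)`.
  have hderiv : ∀ t ∈ Icc (0 : ℝ) 1, HasDerivWithinAt (fun t ↦ F (c t)) 0 (Icc 0 1) t := by
    intro t ht
    have hO : (fun t' ↦ c t' - c t) =O[𝓝[Icc 0 1] t] fun t' ↦ t' - t :=
      Asymptotics.IsBigO.of_bound _ (eventually_mem_nhdsWithin.mono fun t' ht' ↦ hlip t ht t' ht')
    have hc : Tendsto c (𝓝[Icc 0 1] t) (𝓝 (c t)) := by
      rw [tendsto_iff_norm_sub_tendsto_zero]
      have h0 : Tendsto (fun t' ↦ t' - t) (𝓝[Icc 0 1] t) (𝓝 0) := by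
        have : Tendsto (fun t' ↦ t' - t) (𝓝 t) (𝓝 (t - t)) :=
          (continuous_id.sub continuous_const).continuousAt
        rw [sub_self] at this
        exact this.mono_left nhdsWithin_le_nhds
      simpa using (hO.trans_tendsto h0).norm
    rw [hasDerivWithinAt_iff_isLittleO]
    have := ((hcF t ht).isLittleO.comp_tendsto hc).trans_isBigO hO
    simpa [Function.comp_def] using this
  have h01 := (convex_Icc (0 : ℝ) 1).norm_image_sub_le_of_norm_hasDerivWithin_le (C := 0)
    hderiv (by simp) (left_mem_Icc.2 zero_le_one) (right_mem_Icc.2 zero_le_one)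
  have h0 : c 0 = p := hinj _ (hcU 0 (by simp)) _ hp (by rw [hcψ 0 (by simp)]; simp)
  have h1 : c 1 = q := hinj _ (hcU 1 (by simp)) _ hq (by rw [hcψ 1 (by simp)]; simp)
  rw [zero_mul, norm_le_zero_iff, h0, h1, sub_eq_zero] at h01
  exact h01

/-- Let a compact abelian group act near a fixed point `x` with derivatives `A g` at `x`, uniformly
strictly differentiable there. A function whose derivative vanishes at the fixed points of the
group is locally constant along the fixed point set near `x`. -/
theorem eventually_eq_of_mem_fixedPoints [CompleteSpace H] {G M : Type*} [CommGroup G] [TopologicalSpace G]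
    [IsTopologicalGroup G] [CompactSpace G] [TopologicalSpace M] [MulAction G M]
    [ContinuousSMul G M] (e : OpenPartialHomeomorph M H) {x : M} (hx : x ∈ e.source)
    (hfix : ∀ g : G, g • x = x) (A : G → H →L[ℝ] H) (hA : Continuous A)
    (hAmul : ∀ g h, A (g * h) = A g ∘L A h) (hAone : A 1 = ContinuousLinearMap.id ℝ H)
    (hest : ∀ ε > 0, ∀ᶠ w : H × H in 𝓝 (e x, e x), ∀ g : G,
      ‖e (g • e.symm w.1) - e (g • e.symm w.2) - A g (w.1 - w.2)‖ ≤ ε * ‖w.1 - w.2‖)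
    (f : M → ℝ) (hf : ∀ y ∈ e.source, (∀ g : G, g • y = y) →
      HasFDerivAt (f ∘ e.symm) (0 : H →L[ℝ] ℝ) (e y)) :
    ∀ᶠ y in 𝓝 x, (∀ g : G, g • y = y) → f y = f x := by
  let _ : MeasurableSpace G := borel G
  have : BorelSpace G := ⟨rfl⟩
  let ν : Measure G := Measure.haarMeasure ⊤
  have hν : IsProbabilityMeasure ν := ⟨by
    simpa using Measure.haarMeasure_self (K₀ := (⊤ : TopologicalSpace.PositiveCompacts G))⟩
  set p := e x with hp
  have hpx : e.symm p = x := e.left_inv hx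
  obtain ⟨C, hC⟩ := isCompact_univ.exists_bound_of_continuousOn (f := A) hA.continuousOn
  have hC0 : 0 ≤ C := (norm_nonneg _).trans (hC 1 trivial)
  have hinv : ∀ g v, A g⁻¹ (A g v) = v := fun g v ↦ by
    rw [← ContinuousLinearMap.comp_apply, ← hAmul, inv_mul_cancel, hAone,
      ContinuousLinearMap.id_apply]
  have hcont : ∀ g : G, ContinuousAt (fun z : H × G ↦ z.2 • e.symm z.1) (p, g) := fun g ↦
    continuousAt_snd.smul (ContinuousAt.comp (g := e.symm) (f := Prod.fst) (x := (p, g))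
      (e.continuousAt_symm (e.map_source hx)) continuousAt_fst)
  have hsrc : ∀ᶠ u in 𝓝 p, ∀ g : G, g • e.symm u ∈ e.source := by
    have := isCompact_univ.eventually_forall_of_forall_eventually (x₀ := p)
      (P := fun u (g : G) ↦ g • e.symm u ∈ e.source) fun g _ ↦
        (hcont g).eventually (e.open_source.mem_nhds (by simpa [hpx, hfix] using hx))
    simpa using this
  have hest' : ∀ᶠ w : H × H in 𝓝 (p, p), ∀ g : G,
      ‖e (g • e.symm w.1) - e (g • e.symm w.2) - A g (w.1 - w.2)‖ ≤
        -- Applying `A g⁻¹` costs a factor `C`; this constant keeps the product below `1 / 2`.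
        (1 / (2 * (C + 1))) * ‖w.1 - w.2‖ := hest _ (by positivity)
  obtain ⟨r₁, hr₁, h₁⟩ := Metric.eventually_nhds_iff_ball.1 hest'
  obtain ⟨r₂, hr₂, h₂⟩ := Metric.eventually_nhds_iff_ball.1
    (hsrc.and (e.open_target.mem_nhds (e.map_source hx)))
  set r := min r₁ r₂
  have hr : 0 < r := lt_min hr₁ hr₂
  have hUsrc : ∀ u ∈ Metric.ball p r, ∀ g : G, g • e.symm u ∈ e.source := fun u hu ↦
    (h₂ u (Metric.ball_subset_ball (min_le_right _ _) hu)).1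
  have hUt : ∀ u ∈ Metric.ball p r, u ∈ e.target := fun u hu ↦
    (h₂ u (Metric.ball_subset_ball (min_le_right _ _) hu)).2
  have hUest : ∀ u ∈ Metric.ball p r, ∀ v ∈ Metric.ball p r, ∀ g : G,
      ‖e (g • e.symm u) - e (g • e.symm v) - A g (u - v)‖ ≤ (1 / (2 * (C + 1))) * ‖u - v‖ := by
    intro u hu v hv
    refine h₁ (u, v) ?_
    rw [← ball_prod_same]
    exact ⟨Metric.ball_subset_ball (min_le_left _ _) hu, Metric.ball_subset_ball (min_le_left _ _) hv⟩
  -- The averaged chart: it conjugates the action to the linear action `A` and differs from the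
  -- identity by a `1 / 2`-Lipschitz map. Fixed points near `x` thus correspond to `A`-invariant
  -- vectors, which form a linear subspace.
  let ψ : H → H := fun u ↦ ∫ g, A g⁻¹ (e (g • e.symm u)) ∂ν
  have hint : ∀ u ∈ Metric.ball p r, Integrable (fun g ↦ A g⁻¹ (e (g • e.symm u))) ν := by
    intro u hu
    refine Continuous.integrable_of_hasCompactSupport ?_ (HasCompactSupport.of_compactSpace _)
    refine (hA.comp continuous_inv).clm_apply ?_
    exact e.continuousOn.comp_continuous (by fun_prop) (hUsrc u hu)
  have hψ : ApproximatesLinearOn ψ (ContinuousLinearMap.id ℝ H) (Metric.ball p r) (1 / 2) := by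
    intro u hu v hv
    have heq : ψ u - ψ v - (u - v) =
        ∫ g, A g⁻¹ (e (g • e.symm u) - e (g • e.symm v) - A g (u - v)) ∂ν := by
      simp only [map_sub (A _), hinv]
      rw [integral_sub (f := fun g ↦ A g⁻¹ (e (g • e.symm u)) - A g⁻¹ (e (g • e.symm v)))
        ((hint u hu).sub (hint v hv)) (integrable_const _),
        integral_sub (hint u hu) (hint v hv), integral_const]
      simp [ψ]
    rw [ContinuousLinearMap.id_apply, heq]
    refine (norm_integral_le_of_norm_le_const (C := 1 / 2 * ‖u - v‖) (ae_of_all _ fun g ↦ ?_)).trans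
      (by simp)
    calc ‖A g⁻¹ (e (g • e.symm u) - e (g • e.symm v) - A g (u - v))‖
        ≤ C * ((1 / (2 * (C + 1))) * ‖u - v‖) :=
          (A g⁻¹).le_of_opNorm_le_of_le (hC _ trivial) (hUest u hu v hv g)
      _ = (C / (C + 1)) * (1 / 2 * ‖u - v‖) := by field_simp
      _ ≤ 1 * (1 / 2 * ‖u - v‖) := by
          gcongr
          rw [div_le_one (by positivity)]
          linarith
      _ = 1 / 2 * ‖u - v‖ := one_mul _
  have hequiv : ∀ u ∈ Metric.ball p r, ∀ h : G, ψ (e (h • e.symm u)) = A h (ψ u) := by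
    intro u hu h
    have hpt : ∀ g : G, A g⁻¹ (e (g • e.symm (e (h • e.symm u)))) =
        A h (A (g * h)⁻¹ (e ((g * h) • e.symm u))) := by
      intro g
      rw [e.left_inv (hUsrc u hu h), smul_smul, ← ContinuousLinearMap.comp_apply, ← hAmul]
      simp
    simp only [ψ, hpt]
    -- Haar measure is right invariant because the group is commutative.
    rw [integral_mul_right_eq_self (fun g ↦ A h (A g⁻¹ (e (g • e.symm u)))) h]
    exact (A h).integral_comp_comm (hint u hu)
  have hsmall : ∀ᶠ u in 𝓝 p, ∀ g : G, e (g • e.symm u) ∈ Metric.ball p r := by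
    have := isCompact_univ.eventually_forall_of_forall_eventually (x₀ := p)
      (P := fun u (g : G) ↦ e (g • e.symm u) ∈ Metric.ball p r) fun g _ ↦ by
        have h1 : ContinuousAt (fun z : H × G ↦ e (z.2 • e.symm z.1)) (p, g) :=
          ContinuousAt.comp (g := e) (by simpa [hpx, hfix] using e.continuousAt hx) (hcont g)
        exact h1.eventually (Metric.isOpen_ball.mem_nhds (by simp [hpx, hfix, ← hp, hr]))
    simpa using this
  obtain ⟨r', hr', h'⟩ := Metric.eventually_nhds_iff_ball.1 hsmall
  set U' := Metric.ball p (min r r') with hU'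
  have hU'U : U' ⊆ Metric.ball p r := Metric.ball_subset_ball (min_le_left _ _)
  have hU'p : U' ∈ 𝓝 p := Metric.ball_mem_nhds _ (lt_min hr hr')
  have hψ' := hψ.mono_set hU'U
  let R : (ContinuousLinearMap.id ℝ H).NonlinearRightInverse :=
    { toFun := id, nnnorm := 1, bound' := fun y ↦ by simp, right_inv' := fun y ↦ rfl }
  have himg : ψ '' U' ∈ 𝓝 (ψ p) := hψ'.image_mem_nhds R hU'p
    (Or.inr (by simp [R]; norm_num [← NNReal.coe_lt_coe]))
  obtain ⟨δ, hδ, hball⟩ := Metric.mem_nhds_iff.1 himg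
  have hψc : ContinuousAt ψ p := hψ'.continuousOn.continuousAt hU'p
  -- By equivariance `c` and its translate have the same image under `ψ`, which is injective on the
  -- ball containing both.
  have hfixed : ∀ c ∈ U', (∀ h : G, A h (ψ c) = ψ c) → ∀ h : G, h • e.symm c = e.symm c := by
    intro c hc hAc h
    have hcU := hU'U hc
    have h1 : ψ (e (h • e.symm c)) = ψ c := by rw [hequiv c hcU, hAc]
    have h2 : e (h • e.symm c) ∈ Metric.ball p r :=
      h' c (Metric.ball_subset_ball (min_le_right _ _) hc) h
    have h3 : e (h • e.symm c) = c := by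
      have h4 := hψ _ h2 _ hcU
      rw [h1, sub_self, zero_sub, norm_neg, ContinuousLinearMap.id_apply] at h4
      have h5 : (((1 / 2 : NNReal)) : ℝ) = 1 / 2 := by norm_num
      rw [h5] at h4
      refine sub_eq_zero.1 (norm_le_zero_iff.1 ?_)
      linarith
    rw [← e.left_inv (hUsrc c hcU h), h3]
  have hψfix : ∀ y ∈ e.source, e y ∈ U' → (∀ g : G, g • y = y) → ∀ h, A h (ψ (e y)) = ψ (e y) := by
    intro y hy hyU hyf h
    rw [← hequiv _ (hU'U hyU), e.left_inv hy, hyf]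
  have hpU' : p ∈ U' := mem_of_mem_nhds hU'p
  have hec := e.continuousAt hx
  filter_upwards [e.open_source.mem_nhds hx, hec.eventually hU'p,
    (ContinuousAt.comp (g := ψ) hψc hec).eventually (Metric.ball_mem_nhds _ hδ)] with y hy hyU hyδ hyf
  have key := eq_of_hasFDerivAt_zero_of_approximatesLinearOn hψ' hpU' hyU (F := f ∘ e.symm) ?_
  · simpa [hpx, e.left_inv hy] using key
  intro t ht
  have hw : ψ p + t • (ψ (e y) - ψ p) ∈ Metric.ball (ψ p) δ :=
    (convex_ball (ψ p) δ).add_smul_sub_mem (Metric.mem_ball_self hδ) hyδ ht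
  obtain ⟨c, hcU, hc⟩ := hball hw
  refine ⟨c, hcU, hc, ?_⟩
  -- The segment between two invariant vectors is invariant, so its lift consists of fixed points,
  -- where the derivative of `f` vanishes.
  have hcf := hfixed c hcU fun h ↦ by
    rw [hc, map_add, map_smul, map_sub, hψfix y hy hyU hyf, hψfix x hx hpU' hfix]
  have hct := hUt c (hU'U hcU)
  simpa [e.right_inv hct] using hf (e.symm c) (e.map_target hct) hcf

end Linearization

/-! ### Isotropy representation of the torus in a chart. -/

section LocalForm

variable {H : Type*} [NormedAddCommGroup H] [InnerProductSpace ℝ H]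
  {M : Type*} [TopologicalSpace M] [ChartedSpace H M]
  {N : ℕ} [MulAction (Fin N → Circle) M]

theorem continuousSMul_of_contMDiff
    (hsm : ContMDiff ((ModelWithCorners.pi fun _ : Fin N ↦ 𝓡 1).prod 𝓘(ℝ, H)) 𝓘(ℝ, H) ∞
      (fun p : (Fin N → Circle) × M ↦ p.1 • p.2)) : ContinuousSMul (Fin N → Circle) M :=
  ⟨hsm.continuous⟩

variable [IsManifold 𝓘(ℝ, H) ∞ M]

theorem contDiffAt_chart_torusExp_smul
    (hsm : ContMDiff ((ModelWithCorners.pi fun _ : Fin N ↦ 𝓡 1).prod 𝓘(ℝ, H)) 𝓘(ℝ, H) ∞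
      (fun p : (Fin N → Circle) × M ↦ p.1 • p.2)) {x : M} {s : Fin N → ℝ}
    (hs : torusExp s • x = x) :
    ContDiffAt ℝ ∞ (fun z : (Fin N → ℝ) × H ↦
      chartAt H x (torusExp z.1 • (chartAt H x).symm z.2)) (s, chartAt H x x) := by
  rw [← contMDiffAt_iff_contDiffAt]
  have hx := mem_chart_source H x
  have hsymm : ContMDiffAt 𝓘(ℝ, H) 𝓘(ℝ, H) ∞ (chartAt H x).symm (chartAt H x x) :=
    (contMDiffOn_chart_symm (I := 𝓘(ℝ, H)) (n := ∞)).contMDiffAt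
      ((chartAt H x).open_target.mem_nhds ((chartAt H x).map_source hx))
  have hchart : ContMDiffAt 𝓘(ℝ, H) 𝓘(ℝ, H) ∞ (chartAt H x) x :=
    contMDiffOn_chart.contMDiffAt ((chartAt H x).open_source.mem_nhds hx)
  have hact : ContMDiffAt 𝓘(ℝ, (Fin N → ℝ) × H) 𝓘(ℝ, H) ∞
      (fun z : (Fin N → ℝ) × H ↦ torusExp z.1 • (chartAt H x).symm z.2) (s, chartAt H x x) :=
    ContMDiffAt.comp (g := fun p : (Fin N → ℝ) × M ↦ torusExp p.1 • p.2)
      (f := fun z : (Fin N → ℝ) × H ↦ (z.1, (chartAt H x).symm z.2)) _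
      (contMDiff_torusExp_smul hsm _)
      (contDiffAt_fst.contMDiffAt.prodMk
        (ContMDiffAt.comp (g := (chartAt H x).symm) (s, chartAt H x x) hsymm
          contDiffAt_snd.contMDiffAt))
  refine ContMDiffAt.comp (g := chartAt H x) _ ?_ hact
  simpa [(chartAt H x).left_inv hx, hs] using hchart

/-- The derivative at `x`, in the chart at `x`, of the action of a torus element. -/
def isotropy (x : M) (g : Fin N → Circle) : H →L[ℝ] H :=
  fderiv ℝ (fun u ↦ chartAt H x (g • (chartAt H x).symm u)) (chartAt H x x)

/-- Joint smoothness gives differentiability also for `t` near `s` whose torus element does not fix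
`x`. This serves both the continuity of `isotropy` and the transport of velocities along orbits. -/
theorem eventually_hasFDerivAt_isotropy
    (hsm : ContMDiff ((ModelWithCorners.pi fun _ : Fin N ↦ 𝓡 1).prod 𝓘(ℝ, H)) 𝓘(ℝ, H) ∞
      (fun p : (Fin N → Circle) × M ↦ p.1 • p.2)) {x : M} {s : Fin N → ℝ}
    (hs : torusExp s • x = x) :
    ∀ᶠ t in 𝓝 s, HasFDerivAt (fun u ↦ chartAt H x (torusExp t • (chartAt H x).symm u))
      (fderiv ℝ (fun z : (Fin N → ℝ) × H ↦ chartAt H x (torusExp z.1 • (chartAt H x).symm z.2))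
        (t, chartAt H x x) ∘L ContinuousLinearMap.inr ℝ (Fin N → ℝ) H) (chartAt H x x) := by
  have h1 := ((contDiffAt_chart_torusExp_smul hsm hs).of_le (m := 1) (by simp)).eventually (by simp)
  have h2 : Tendsto (fun t : Fin N → ℝ ↦ (t, chartAt H x x)) (𝓝 s) (𝓝 (s, chartAt H x x)) :=
    (Continuous.prodMk_left _).continuousAt
  filter_upwards [h2.eventually h1] with t ht
  exact (ht.differentiableAt (by simp)).hasFDerivAt.comp (chartAt H x x)
    (hasFDerivAt_prodMk_right t (chartAt H x x))

theorem hasFDerivAt_isotropy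
    (hsm : ContMDiff ((ModelWithCorners.pi fun _ : Fin N ↦ 𝓡 1).prod 𝓘(ℝ, H)) 𝓘(ℝ, H) ∞
      (fun p : (Fin N → Circle) × M ↦ p.1 • p.2)) {x : M} {g : Fin N → Circle} (hg : g • x = x) :
    HasFDerivAt (fun u ↦ chartAt H x (g • (chartAt H x).symm u)) (isotropy x g)
      (chartAt H x x) := by
  obtain ⟨s, rfl⟩ := torusExp_surjective g
  exact (eventually_hasFDerivAt_isotropy hsm hg).self_of_nhds.differentiableAt.hasFDerivAt

theorem continuousAt_isotropy
    (hsm : ContMDiff ((ModelWithCorners.pi fun _ : Fin N ↦ 𝓡 1).prod 𝓘(ℝ, H)) 𝓘(ℝ, H) ∞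
      (fun p : (Fin N → Circle) × M ↦ p.1 • p.2)) {x : M} {g : Fin N → Circle} (hg : g • x = x) :
    ContinuousAt (isotropy (H := H) x) g := by
  obtain ⟨s, rfl⟩ := torusExp_surjective g
  have h1 := ((contDiffAt_chart_torusExp_smul hsm hg).fderiv_right (m := 0) (by simp)).continuousAt
  have h2 : ContinuousAt (fun t : Fin N → ℝ ↦ (t, chartAt H x x)) s :=
    (Continuous.prodMk_left _).continuousAt
  have h3 : ContinuousAt (fun t ↦ isotropy (H := H) x (torusExp t)) s := by
    refine ContinuousAt.congr ?_
      ((eventually_hasFDerivAt_isotropy hsm hg).mono fun t ht ↦ ht.fderiv.symm)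
    exact (ContinuousAt.comp (f := fun t : Fin N → ℝ ↦ (t, chartAt H x x)) h1 h2).clm_comp
      continuousAt_const
  have h4 : Tendsto (isotropy (H := H) x) (map torusExp (𝓝 s)) (𝓝 (isotropy x (torusExp s))) := h3
  exact h4.mono_left (nhds_torusExp_le_map s)

theorem isotropy_mul
    (hsm : ContMDiff ((ModelWithCorners.pi fun _ : Fin N ↦ 𝓡 1).prod 𝓘(ℝ, H)) 𝓘(ℝ, H) ∞
      (fun p : (Fin N → Circle) × M ↦ p.1 • p.2)) {x : M} {g h : Fin N → Circle}
    (hg : g • x = x) (hh : h • x = x) :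
    isotropy (H := H) x (g * h) = isotropy x g ∘L isotropy x h := by
  have := continuousSMul_of_contMDiff hsm
  set e := chartAt H x
  have hx : x ∈ e.source := mem_chart_source H x
  have h0 : e (h • e.symm (e x)) = e x := by rw [e.left_inv hx, hh]
  have h1 : HasFDerivAt (fun u ↦ e (g • e.symm u)) (isotropy x g) (e (h • e.symm (e x))) := by
    rw [h0]; exact hasFDerivAt_isotropy hsm hg
  have h2 := h1.comp (e x) (hasFDerivAt_isotropy hsm hh)
  have h3 : ContinuousAt (fun u ↦ h • e.symm u) (e x) :=
    (e.continuousAt_symm (e.map_source hx)).const_smul h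
  refine (h2.congr_of_eventuallyEq ?_).fderiv
  filter_upwards [h3.eventually (e.open_source.mem_nhds (by simpa [e.left_inv hx, hh] using hx))]
    with u hu
  simp only [Function.comp_apply]
  rw [e.left_inv hu, mul_smul]

omit [IsManifold 𝓘(ℝ, H) ∞ M] in
theorem isotropy_one (x : M) :
    isotropy (N := N) (H := H) x 1 = ContinuousLinearMap.id ℝ H := by
  have hx := mem_chart_source H x
  refine ((hasFDerivAt_id _).congr_of_eventuallyEq ?_).fderiv
  filter_upwards [(chartAt H x).open_target.mem_nhds ((chartAt H x).map_source hx)] with u hu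
  simp [(chartAt H x).right_inv hu]

/-- Strict differentiability of the action in both variables, applied to two points with the same
torus parameter, gives the estimate with the derivative frozen at `g`. Continuity of `isotropy`
supplies the other `ε / 2`. Being local in the group element, the bound becomes uniform over a
compact subgroup. -/
theorem eventually_norm_sub_isotropy_le
    (hsm : ContMDiff ((ModelWithCorners.pi fun _ : Fin N ↦ 𝓡 1).prod 𝓘(ℝ, H)) 𝓘(ℝ, H) ∞
      (fun p : (Fin N → Circle) × M ↦ p.1 • p.2)) {x : M} {g : Fin N → Circle} (hg : g • x = x)
    {ε : ℝ} (hε : 0 < ε) :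
    ∀ᶠ z : (H × H) × (Fin N → Circle) in 𝓝 ((chartAt H x x, chartAt H x x), g),
      ‖chartAt H x (z.2 • (chartAt H x).symm z.1.1) - chartAt H x (z.2 • (chartAt H x).symm z.1.2)
        - isotropy x z.2 (z.1.1 - z.1.2)‖ ≤ ε * ‖z.1.1 - z.1.2‖ := by
  have hcont := continuousAt_isotropy hsm hg
  have hA := hasFDerivAt_isotropy hsm hg
  obtain ⟨s, rfl⟩ := torusExp_surjective g
  obtain ⟨l, hl, hlt⟩ := exists_torusExp_section s
  have hstrict := (contDiffAt_chart_torusExp_smul hsm hg).hasStrictFDerivAt (by simp)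
  have hD := hA.unique (eventually_hasFDerivAt_isotropy hsm hg).self_of_nhds
  have h1 := hstrict.isLittleO.def (half_pos hε)
  set e := chartAt H x
  set p := e x
  have htend : Tendsto (fun z : (H × H) × (Fin N → Circle) ↦ ((l z.2, z.1.1), (l z.2, z.1.2)))
      (𝓝 ((p, p), torusExp s)) (𝓝 ((s, p), (s, p))) := by
    have ht2 : Tendsto (fun z : (H × H) × (Fin N → Circle) ↦ l z.2) (𝓝 ((p, p), torusExp s)) (𝓝 s) :=
      hlt.comp continuousAt_snd
    have ht11 : ContinuousAt (fun z : (H × H) × (Fin N → Circle) ↦ z.1.1) ((p, p), torusExp s) := by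
      fun_prop
    have ht12 : ContinuousAt (fun z : (H × H) × (Fin N → Circle) ↦ z.1.2) ((p, p), torusExp s) := by
      fun_prop
    exact (ht2.prodMk_nhds ht11).prodMk_nhds (ht2.prodMk_nhds ht12)
  have h2 : ∀ᶠ z : (H × H) × (Fin N → Circle) in 𝓝 ((p, p), torusExp s),
      ‖isotropy (H := H) x z.2 - isotropy x (torusExp s)‖ < ε / 2 := by
    have : ContinuousAt (fun z : (H × H) × (Fin N → Circle) ↦ isotropy (H := H) x z.2)
        ((p, p), torusExp s) :=
      ContinuousAt.comp (g := isotropy x) (f := Prod.snd) hcont continuousAt_snd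
    simpa only [dist_eq_norm] using Metric.tendsto_nhds.1 this (ε / 2) (half_pos hε)
  filter_upwards [htend.eventually h1, h2] with z hz1 hz2
  simp only [hl] at hz1
  have h3 : ∀ w : H, fderiv ℝ (fun z : (Fin N → ℝ) × H ↦ e (torusExp z.1 • e.symm z.2)) (s, p) (0, w)
      = isotropy x (torusExp s) w := fun w ↦ by rw [hD]; simp
  have h4 : ((l z.2, z.1.1) - (l z.2, z.1.2) : (Fin N → ℝ) × H) = (0, z.1.1 - z.1.2) := by simp
  rw [h4, h3, Prod.norm_mk, norm_zero, max_eq_right (norm_nonneg _)] at hz1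
  have h5 : ‖(isotropy x z.2 - isotropy x (torusExp s) : H →L[ℝ] H) (z.1.1 - z.1.2)‖ ≤
      ε / 2 * ‖z.1.1 - z.1.2‖ := ContinuousLinearMap.le_of_opNorm_le _ hz2.le _
  calc _ = ‖(e (z.2 • e.symm z.1.1) - e (z.2 • e.symm z.1.2)
          - isotropy (H := H) x (torusExp s) (z.1.1 - z.1.2)) -
          (isotropy x z.2 - isotropy x (torusExp s) : H →L[ℝ] H) (z.1.1 - z.1.2)‖ := by
        rw [sub_apply]; congr 1; abel
    _ ≤ ε / 2 * ‖z.1.1 - z.1.2‖ + ε / 2 * ‖z.1.1 - z.1.2‖ :=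
        (norm_sub_le _ _).trans (add_le_add hz1 h5)
    _ = ε * ‖z.1.1 - z.1.2‖ := by ring

/-- A function whose derivative vanishes at the fixed points of a closed subgroup of a torus acting
smoothly is locally constant along the fixed point set. -/
theorem eventually_eq_of_forall_mem_smul_eq [CompleteSpace H]
    (hsm : ContMDiff ((ModelWithCorners.pi fun _ : Fin N ↦ 𝓡 1).prod 𝓘(ℝ, H)) 𝓘(ℝ, H) ∞
      (fun p : (Fin N → Circle) × M ↦ p.1 • p.2)) (K : Subgroup (Fin N → Circle))
    (hK : IsClosed (K : Set (Fin N → Circle))) {x : M} (hx : ∀ g ∈ K, g • x = x) (f : M → ℝ)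
    (hf : ∀ y ∈ (chartAt H x).source, (∀ g ∈ K, g • y = y) →
      HasFDerivAt (f ∘ (chartAt H x).symm) (0 : H →L[ℝ] ℝ) (chartAt H x y)) :
    ∀ᶠ y in 𝓝 x, (∀ g ∈ K, g • y = y) → f y = f x := by
  have := continuousSMul_of_contMDiff hsm
  have : CompactSpace K := isCompact_iff_compactSpace.1 hK.isCompact
  have : ContinuousSMul K M := ⟨by
    have : Continuous fun q : K × M ↦ (q.1 : Fin N → Circle) • q.2 := by fun_prop
    exact this⟩
  have key := eventually_eq_of_mem_fixedPoints (G := K) (chartAt H x) (mem_chart_source H x)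
    (fun g ↦ hx g g.2) (fun g ↦ isotropy x (g : Fin N → Circle))
    (continuous_iff_continuousAt.2 fun g ↦
      ContinuousAt.comp (g := isotropy x) (continuousAt_isotropy hsm (hx g g.2))
        continuous_subtype_val.continuousAt)
    (fun g h ↦ isotropy_mul hsm (hx g g.2) (hx h h.2)) (isotropy_one x) ?_ f
    (fun y hy hyf ↦ hf y hy fun g hg ↦ hyf ⟨g, hg⟩)
  · exact key.mono fun y hy hyf ↦ hy fun g ↦ hyf g g.2
  · intro ε hε
    have := hK.isCompact.eventually_forall_of_forall_eventually
      (P := fun (w : H × H) (g : Fin N → Circle) ↦ ‖chartAt H x (g • (chartAt H x).symm w.1) -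
        chartAt H x (g • (chartAt H x).symm w.2) - isotropy x g (w.1 - w.2)‖ ≤ ε * ‖w.1 - w.2‖)
      fun g hg ↦
      eventually_norm_sub_isotropy_le hsm (hx g hg) hε
    exact this.mono fun w hw g ↦ hw g g.2

end LocalForm

/-! ### Stabilizer algebras and their semicontinuity. -/

section StabilizerAlgebra

variable {M : Type*} {n : ℕ} [AddAction (EuclideanSpace ℝ (Fin n)) M]

variable (n) in
/-- The Lie algebra of the stabilizer of a point. -/
def stabilizerAlgebra (x : M) : Submodule ℝ (EuclideanSpace ℝ (Fin n)) where
  carrier := {ξ | ∀ t : ℝ, (t • ξ) +ᵥ x = x}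
  zero_mem' t := by simp
  add_mem' {ξ η} hξ hη t := by rw [smul_add, add_vadd, hη, hξ]
  smul_mem' c ξ hξ t := by rw [smul_smul]; exact hξ _

/-- Every `t • ξ` is an integer multiple of a vector `(t / (m + 1)) • ξ` close to zero. -/
theorem mem_stabilizerAlgebra_of_eventually {x : M} {ξ : EuclideanSpace ℝ (Fin n)}
    (h : ∀ᶠ t : ℝ in 𝓝 0, (t • ξ) +ᵥ x = x) : ξ ∈ stabilizerAlgebra n x := by
  intro t
  have h1 : Tendsto (fun m : ℕ ↦ t / ((m : ℝ) + 1)) atTop (𝓝 0) := by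
    simpa [div_eq_mul_one_div t] using tendsto_one_div_add_atTop_nhds_zero_nat.const_mul t
  obtain ⟨m, hm⟩ := (h1.eventually h).exists
  have h2 : (t / ((m : ℝ) + 1)) • ξ ∈ AddAction.stabilizer (EuclideanSpace ℝ (Fin n)) x := hm
  have h3 := nsmul_mem h2 (m + 1)
  rw [← Nat.cast_smul_eq_nsmul ℝ, smul_smul] at h3
  have h4 : ((m + 1 : ℕ) : ℝ) * (t / ((m : ℝ) + 1)) = t := by
    push_cast; field_simp
  rw [h4] at h3
  exact h3

variable {H : Type*} [NormedAddCommGroup H] [InnerProductSpace ℝ H]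
  [TopologicalSpace M] [ChartedSpace H M] [IsManifold 𝓘(ℝ, H) ∞ M]
  {N : ℕ} [MulAction (Fin N → Circle) M]

/-- The group law carries the velocity at time `0` to the velocity at time `t` by the derivative of
the action of `t • ξ`. A zero velocity thus stays zero, and the orbit is constant for small times.
-/
theorem mem_stabilizerAlgebra_of_hasDerivAt_zero
    (hsm : ContMDiff ((ModelWithCorners.pi fun _ : Fin N ↦ 𝓡 1).prod 𝓘(ℝ, H)) 𝓘(ℝ, H) ∞
      (fun p : (Fin N → Circle) × M ↦ p.1 • p.2))
    {a : EuclideanSpace ℝ (Fin n) →L[ℝ] (Fin N → ℝ)}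
    (ha : ∀ (s : EuclideanSpace ℝ (Fin n)) (x : M), s +ᵥ x = torusExp (a s) • x)
    {x : M} {ξ : EuclideanSpace ℝ (Fin n)}
    (hξ : HasDerivAt (fun t : ℝ ↦ chartAt H x ((t • ξ) +ᵥ x)) 0 0) :
    ξ ∈ stabilizerAlgebra n x := by
  have := continuousSMul_of_contMDiff hsm
  have hx := mem_chart_source H x
  have hT : Continuous (torusExp (N := N)) := contMDiff_torusExp.continuous
  have hc : Continuous fun t : ℝ ↦ (t • ξ) +ᵥ x := by
    simp only [ha]
    exact (hT.comp (by fun_prop : Continuous fun t : ℝ ↦ a (t • ξ))).smul continuous_const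
  have ha0 : Tendsto (fun t : ℝ ↦ a (t • ξ)) (𝓝 0) (𝓝 0) := by
    have : Continuous fun t : ℝ ↦ a (t • ξ) := by fun_prop
    exact this.tendsto' 0 0 (by simp)
  have hd := ha0.eventually (eventually_hasFDerivAt_isotropy (H := H) hsm (x := x) (s := 0)
    (by rw [torusExp_zero, one_smul]))
  have hsrc : ∀ᶠ t : ℝ in 𝓝 0, (t • ξ) +ᵥ x ∈ (chartAt H x).source :=
    hc.continuousAt.eventually ((chartAt H x).open_source.mem_nhds (by simp))
  obtain ⟨δ, hδ, hball⟩ := Metric.eventually_nhds_iff_ball.1 (hd.and hsrc)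
  have hderiv : ∀ t ∈ Metric.ball (0 : ℝ) δ, HasDerivWithinAt
      (fun t : ℝ ↦ chartAt H x ((t • ξ) +ᵥ x)) 0 (Metric.ball (0 : ℝ) δ) t := by
    intro t ht
    obtain ⟨h1, -⟩ := hball t ht
    have hξ' : HasDerivAt (fun r : ℝ ↦ chartAt H x (((r - t) • ξ) +ᵥ x)) 0 t := by
      have h0 : HasDerivAt (fun t : ℝ ↦ chartAt H x ((t • ξ) +ᵥ x)) 0 (t - t) := by
        rwa [sub_self]
      simpa using h0.comp_sub_const t t
    have h1' := h1
    have hpt : chartAt H x x = chartAt H x (((t - t) • ξ) +ᵥ x) := by simp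
    rw [hpt] at h1'
    have h2 := h1'.comp_hasDerivAt t hξ'
    simp only [map_zero] at h2
    refine (h2.congr_of_eventuallyEq ?_).hasDerivWithinAt
    have h3 : Tendsto (fun r : ℝ ↦ r - t) (𝓝 t) (𝓝 0) := 
      (by fun_prop : Continuous fun r : ℝ ↦ r - t).tendsto' t 0 (sub_self t)
    filter_upwards [h3.eventually hsrc] with r hr
    rw [Function.comp_apply, (chartAt H x).left_inv hr, ← ha, vadd_vadd, ← add_smul,
      add_sub_cancel]
  refine mem_stabilizerAlgebra_of_eventually ?_
  filter_upwards [Metric.ball_mem_nhds 0 hδ] with t ht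
  have h4 := (convex_ball (0 : ℝ) δ).norm_image_sub_le_of_norm_hasDerivWithin_le (C := 0)
    hderiv (by simp) (Metric.mem_ball_self hδ) ht
  rw [zero_mul, norm_le_zero_iff, sub_eq_zero, zero_smul, zero_vadd] at h4
  exact (chartAt H x).injOn (hball t ht).2 hx h4

theorem mem_stabilizerAlgebra_of_generator_eq_zero
    (hsm : ContMDiff ((ModelWithCorners.pi fun _ : Fin N ↦ 𝓡 1).prod 𝓘(ℝ, H)) 𝓘(ℝ, H) ∞
      (fun p : (Fin N → Circle) × M ↦ p.1 • p.2))
    {a : EuclideanSpace ℝ (Fin n) →L[ℝ] (Fin N → ℝ)}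
    (ha : ∀ (s : EuclideanSpace ℝ (Fin n)) (x : M), s +ᵥ x = torusExp (a s) • x)
    {x : M} {ξ : EuclideanSpace ℝ (Fin n)} (hξ : generator H ξ x = 0) :
    ξ ∈ stabilizerAlgebra n x := by
  refine mem_stabilizerAlgebra_of_hasDerivAt_zero hsm ha ?_
  have : IsManifold 𝓘(ℝ, H) 1 M := IsManifold.of_le (n := ∞) (by simp)
  have hc : ContMDiff 𝓘(ℝ, ℝ) 𝓘(ℝ, H) ∞ (fun t : ℝ ↦ (t • ξ) +ᵥ x) := by
    simp only [ha]
    have h1 : ContDiff ℝ ∞ fun t : ℝ ↦ a (t • ξ) := by fun_prop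
    exact (contMDiff_torusExp_smul hsm).comp (h1.contMDiff.prodMk contMDiff_const)
  have hd : HasMFDerivAt 𝓘(ℝ, ℝ) 𝓘(ℝ, H) (fun t : ℝ ↦ (t • ξ) +ᵥ x) (0 : ℝ)
      (0 : TangentSpace 𝓘(ℝ, ℝ) (0 : ℝ) →L[ℝ] TangentSpace 𝓘(ℝ, H) (((0 : ℝ) • ξ) +ᵥ x)) := by
    have h1 := (hc.mdifferentiableAt (x := 0) (by simp)).hasMFDerivAt
    have h2 : (mfderiv 𝓘(ℝ, ℝ) 𝓘(ℝ, H) (fun t : ℝ ↦ (t • ξ) +ᵥ x) 0 : ℝ →L[ℝ] H) = 0 :=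
      ContinuousLinearMap.ext_ring hξ
    exact h2 ▸ h1
  have he : MDifferentiableAt 𝓘(ℝ, H) 𝓘(ℝ, H) (chartAt H x) (((0 : ℝ) • ξ) +ᵥ x) :=
    mdifferentiableAt_atlas (chart_mem_atlas H x) (by simp)
  have h3 := he.hasMFDerivAt.comp (0 : ℝ) hd
  rw [ContinuousLinearMap.comp_zero] at h3
  have h4 : HasFDerivAt (fun t : ℝ ↦ chartAt H x ((t • ξ) +ᵥ x)) (0 : ℝ →L[ℝ] H) 0 :=
    hasMFDerivAt_iff_hasFDerivAt.1 h3
  exact h4.hasDerivAt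

/-- One-parameter orbits that stay close to `x` are constant. -/
theorem exists_nhds_forall_mem_stabilizerAlgebra
    (hsm : ContMDiff ((ModelWithCorners.pi fun _ : Fin N ↦ 𝓡 1).prod 𝓘(ℝ, H)) 𝓘(ℝ, H) ∞
      (fun p : (Fin N → Circle) × M ↦ p.1 • p.2))
    {a : EuclideanSpace ℝ (Fin n) →L[ℝ] (Fin N → ℝ)}
    (ha : ∀ (s : EuclideanSpace ℝ (Fin n)) (x : M), s +ᵥ x = torusExp (a s) • x) (x : M) :
    ∃ W ∈ 𝓝 x, ∀ ξ : EuclideanSpace ℝ (Fin n), (∀ t : ℝ, (t • ξ) +ᵥ x ∈ W) →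
      ξ ∈ stabilizerAlgebra n x := by
  set e := chartAt H x
  have hx : x ∈ e.source := mem_chart_source H x
  have hdiff : DifferentiableAt ℝ (fun s : EuclideanSpace ℝ (Fin n) ↦ e (s +ᵥ x)) 0 := by
    have h1 : DifferentiableAt ℝ (fun z : (Fin N → ℝ) × H ↦ e (torusExp z.1 • e.symm z.2))
        (a 0, e x) :=
      (contDiffAt_chart_torusExp_smul hsm
        (by rw [map_zero, torusExp_zero, one_smul])).differentiableAt (by simp)
    have h2 : DifferentiableAt ℝ (fun s : EuclideanSpace ℝ (Fin n) ↦ (a s, e x)) 0 := by fun_prop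
    have h3 := DifferentiableAt.comp (0 : EuclideanSpace ℝ (Fin n)) h1 h2
    simpa only [Function.comp_def, e.left_inv hx, ← ha] using h3
  obtain ⟨D, hD⟩ : ∃ D, HasFDerivAt (fun s : EuclideanSpace ℝ (Fin n) ↦ e (s +ᵥ x)) D 0 :=
    ⟨_, hdiff.hasFDerivAt⟩
  have hker : ∀ l, D l = 0 → l ∈ stabilizerAlgebra n x := by
    intro l hl
    refine mem_stabilizerAlgebra_of_hasDerivAt_zero hsm ha ?_
    have h1 : HasDerivAt (fun t : ℝ ↦ t • l) l 0 := by
      simpa using (hasDerivAt_id (0 : ℝ)).smul_const l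
    have h2 : HasFDerivAt (fun s : EuclideanSpace ℝ (Fin n) ↦ e (s +ᵥ x)) D ((0 : ℝ) • l) := by
      rwa [zero_smul]
    have h3 := h2.comp_hasDerivAt (0 : ℝ) h1
    rwa [hl] at h3
  let L : Submodule ℝ (EuclideanSpace ℝ (Fin n)) := D.ker
  let D' : Lᗮ →ₗ[ℝ] H := (D : EuclideanSpace ℝ (Fin n) →ₗ[ℝ] H).domRestrict Lᗮ
  have hD' : D'.ker = ⊥ := by
    rw [LinearMap.ker_eq_bot']
    intro v hv
    have h1 : (v : EuclideanSpace ℝ (Fin n)) ∈ L ⊓ Lᗮ := ⟨hv, v.2⟩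
    rw [Submodule.inf_orthogonal_eq_bot, Submodule.mem_bot] at h1
    exact Subtype.ext h1
  obtain ⟨C, hC, hanti⟩ := D'.exists_antilipschitzWith hD'
  have hlow : ∀ v ∈ Lᗮ, ‖v‖ ≤ C * ‖D v‖ := by
    intro v hv
    have := hanti.le_mul_dist ⟨v, hv⟩ 0
    rwa [dist_zero_right, map_zero, dist_zero_right] at this
  have hC' : (0 : ℝ) < C := hC
  obtain ⟨ρ, hρ, hball⟩ := Metric.eventually_nhds_iff_ball.1
    (hD.isLittleO.def (show (0 : ℝ) < 1 / (2 * C) by positivity))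
  -- The radius is what a displacement `w ∈ Lᗮ` of norm `ρ / 2` is sure to reach: `‖D w‖ ≥ ρ / (2 *
  -- C)`, and the differentiation error uses up at most half of it.
  refine ⟨e.source ∩ e ⁻¹' Metric.ball (e x) (ρ / 2 / (2 * C)),
    e.isOpen_inter_preimage Metric.isOpen_ball |>.mem_nhds
      ⟨hx, Metric.mem_ball_self (by positivity)⟩, fun ξ hξ ↦ ?_⟩
  obtain ⟨l, hl, v, hv, rfl⟩ := Submodule.exists_add_mem_mem_orthogonal (K := L) ξ
  have hlS : l ∈ stabilizerAlgebra n x := hker l hl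
  suffices v = 0 by rw [this, add_zero]; exact hlS
  by_contra hv0
  have hvn : 0 < ‖v‖ := norm_pos_iff.2 hv0
  set w := (ρ / 2 / ‖v‖) • v
  have hw : ‖w‖ = ρ / 2 := by
    rw [norm_smul, Real.norm_of_nonneg (by positivity)]
    field_simp
  have h1 : w +ᵥ x ∈ e ⁻¹' Metric.ball (e x) (ρ / 2 / (2 * C)) := by
    -- The component `l` fixes `x`, so only `v` moves it.
    have := (hξ (ρ / 2 / ‖v‖)).2
    rwa [smul_add, add_comm, add_vadd, hlS] at this
  have h2 : ‖e (w +ᵥ x) - e x‖ < ρ / 2 / (2 * C) := by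
    rwa [mem_preimage, mem_ball_iff_norm] at h1
  have h3 := hball w (by rw [mem_ball_zero_iff, hw]; linarith)
  rw [zero_vadd, sub_zero, hw] at h3
  have h4 : ρ / 2 ≤ C * ‖D w‖ := hw ▸ hlow w (Lᗮ.smul_mem _ hv)
  have h5 : ‖D w‖ ≤ ‖e (w +ᵥ x) - e x‖ + ‖e (w +ᵥ x) - e x - D w‖ := by
    rw [show D w = (e (w +ᵥ x) - e x) - (e (w +ᵥ x) - e x - D w) by abel]
    refine (norm_sub_le _ _).trans_eq ?_
    simp
  have h6 : C * ‖D w‖ < C * (ρ / 2 / (2 * C) + 1 / (2 * C) * (ρ / 2)) := by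
    gcongr
    linarith
  have h7 : C * (ρ / 2 / (2 * C) + 1 / (2 * C) * (ρ / 2)) = ρ / 2 := by
    field_simp; norm_num
  linarith

/-- The stabilizer algebra is upper semicontinuous. -/
theorem eventually_stabilizerAlgebra_le [T2Space M]
    (hsm : ContMDiff ((ModelWithCorners.pi fun _ : Fin N ↦ 𝓡 1).prod 𝓘(ℝ, H)) 𝓘(ℝ, H) ∞
      (fun p : (Fin N → Circle) × M ↦ p.1 • p.2))
    {a : EuclideanSpace ℝ (Fin n) →L[ℝ] (Fin N → ℝ)}
    (ha : ∀ (s : EuclideanSpace ℝ (Fin n)) (x : M), s +ᵥ x = torusExp (a s) • x) (x : M) :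
    ∀ᶠ y in 𝓝 x, stabilizerAlgebra n y ≤ stabilizerAlgebra n x := by
  have := continuousSMul_of_contMDiff hsm
  obtain ⟨W, hW, hWs⟩ := exists_nhds_forall_mem_stabilizerAlgebra (H := H) hsm ha x
  obtain ⟨V, hVW, hVo, hxV⟩ := mem_nhds_iff.1 hW
  have hK : IsCompact {g : Fin N → Circle | g • x ∉ V} :=
    (hVo.isClosed_compl.preimage (by fun_prop : Continuous fun g : Fin N → Circle ↦ g • x)).isCompact
  -- The torus elements taking `x` out of `V` move `x`, hence by compactness move every nearby `y`.
  -- An element fixing `y` therefore keeps `x` inside `V`.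
  have h1 := hK.eventually_forall_of_forall_eventually (x₀ := x) (P := fun y g ↦ g • y ≠ y) (by
    intro g hg
    have ho : IsOpen {z : M × (Fin N → Circle) | z.2 • z.1 ≠ z.1} :=
      isOpen_ne_fun (by fun_prop) (by fun_prop)
    exact ho.mem_nhds fun h : g • x = x ↦ hg (by rwa [h]))
  filter_upwards [h1] with y hy ξ hξ
  refine hWs ξ fun t ↦ hVW ?_
  by_contra hnot
  rw [ha] at hnot
  exact hy _ hnot (by rw [← ha]; exact hξ t)

/-- A function whose derivative vanishes on the fixed point set of a one-parameter subgroup takes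
countably many values there. -/
theorem countable_image_setOf_mem_stabilizerAlgebra [CompleteSpace H] [T2Space M]
    [SecondCountableTopology M]
    (hsm : ContMDiff ((ModelWithCorners.pi fun _ : Fin N ↦ 𝓡 1).prod 𝓘(ℝ, H)) 𝓘(ℝ, H) ∞
      (fun p : (Fin N → Circle) × M ↦ p.1 • p.2))
    {a : EuclideanSpace ℝ (Fin n) →L[ℝ] (Fin N → ℝ)}
    (ha : ∀ (s : EuclideanSpace ℝ (Fin n)) (x : M), s +ᵥ x = torusExp (a s) • x)
    {ξ : EuclideanSpace ℝ (Fin n)} {f : M → ℝ}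
    (hf : ∀ y, ξ ∈ stabilizerAlgebra n y → HasMFDerivAt 𝓘(ℝ, H) 𝓘(ℝ, ℝ) f y 0) :
    (f '' {y | ξ ∈ stabilizerAlgebra n y}).Countable := by
  have := continuousSMul_of_contMDiff hsm
  have : IsManifold 𝓘(ℝ, H) 1 M := IsManifold.of_le (n := ∞) (by simp)
  -- A compact substitute for the one-parameter group of `ξ`: it is closed in the torus and has the
  -- same fixed points.
  let K : Subgroup (Fin N → Circle) := fixingSubgroup _ {y : M | ξ ∈ stabilizerAlgebra n y}
  have hKmem : ∀ g, g ∈ K ↔ ∀ y : M, ξ ∈ stabilizerAlgebra n y → g • y = y := fun g ↦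
    mem_fixingSubgroup_iff _
  have hK : IsClosed (K : Set (Fin N → Circle)) := by
    have : (K : Set (Fin N → Circle)) =
        ⋂ (y : M) (_ : ξ ∈ stabilizerAlgebra n y), {g | g • y = y} := by
      ext g; simp [hKmem]
    rw [this]
    exact isClosed_iInter fun y ↦ isClosed_iInter fun _ ↦
      isClosed_eq (by fun_prop) continuous_const
  have hfix : ∀ y : M, (∀ g ∈ K, g • y = y) ↔ ξ ∈ stabilizerAlgebra n y := by
    refine fun y ↦ ⟨fun h t ↦ ?_, fun h g hg ↦ (hKmem g).1 hg y h⟩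
    rw [ha]
    exact h _ ((hKmem _).2 fun z hz ↦ by rw [← ha]; exact hz t)
  refine countable_image_of_eventually_eq fun x hx ↦ ?_
  have key := eventually_eq_of_forall_mem_smul_eq hsm K hK ((hfix x).2 hx) f fun y hy hyK ↦ ?_
  · exact key.mono fun y h hy ↦ h ((hfix y).2 hy)
  · have h1 : HasMFDerivAt 𝓘(ℝ, H) 𝓘(ℝ, ℝ) f ((chartAt H x).symm (chartAt H x y)) 0 := by
      rw [(chartAt H x).left_inv hy]
      exact hf y ((hfix y).1 hyK)
    have h2 := h1.comp (chartAt H x y) (mdifferentiableAt_atlas_symm (I := 𝓘(ℝ, H))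
      (chart_mem_atlas H x) ((chartAt H x).map_source hy)).hasMFDerivAt
    rw [ContinuousLinearMap.zero_comp] at h2
    exact hasMFDerivAt_iff_hasFDerivAt.1 h2

end StabilizerAlgebra

/-! ### Level hyperplanes and residual sets. -/

section Hyperplanes

variable {n : ℕ}

/-- The hyperplane `⟨ξ, ·⟩ = c`. -/
def levelHyperplane (ξ : EuclideanSpace ℝ (Fin n)) (c : ℝ) :
    AffineSubspace ℝ (EuclideanSpace ℝ (Fin n)) :=
  AffineSubspace.mk' ((c / ‖ξ‖ ^ 2) • ξ) (ℝ ∙ ξ)ᗮ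

theorem mem_levelHyperplane {ξ : EuclideanSpace ℝ (Fin n)} (hξ : ξ ≠ 0) {c : ℝ}
    {w : EuclideanSpace ℝ (Fin n)} : w ∈ levelHyperplane ξ c ↔ inner ℝ ξ w = c := by
  have h : ‖ξ‖ ≠ 0 := norm_ne_zero_iff.2 hξ
  rw [levelHyperplane, AffineSubspace.mem_mk', Submodule.mem_orthogonal_singleton_iff_inner_right,
    vsub_eq_sub, inner_sub_right, inner_smul_right, real_inner_self_eq_norm_sq,
    div_mul_cancel₀ _ (pow_ne_zero 2 h), sub_eq_zero]

theorem isAffineHyperplane_levelHyperplane {ξ : EuclideanSpace ℝ (Fin n)} (hξ : ξ ≠ 0) (c : ℝ) :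
    IsAffineHyperplane (levelHyperplane ξ c) := by
  refine ⟨⟨_, AffineSubspace.self_mem_mk' _ _⟩, ?_⟩
  have h := Submodule.finrank_add_finrank_orthogonal (ℝ ∙ ξ)
  rw [finrank_span_singleton hξ, finrank_euclideanSpace_fin] at h
  rw [levelHyperplane, AffineSubspace.direction_mk', add_comm, h]

/-- A proper affine subspace is closed and Lebesgue null, so its complement is open and dense. -/
theorem IsAffineHyperplane.compl_mem_residual {A : AffineSubspace ℝ (EuclideanSpace ℝ (Fin n))}
    (hA : IsAffineHyperplane A) :
    (A : Set (EuclideanSpace ℝ (Fin n)))ᶜ ∈ residual (EuclideanSpace ℝ (Fin n)) := by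
  refine residual_of_dense_open A.closed_of_finiteDimensional.isOpen_compl ?_
  rw [← interior_eq_empty_iff_dense_compl]
  refine MeasureTheory.Measure.interior_eq_empty_of_null (μ := MeasureTheory.volume)
    (MeasureTheory.Measure.addHaar_affineSubspace _ A ?_)
  rintro rfl
  have h := hA.2
  rw [AffineSubspace.direction_top, finrank_top, finrank_euclideanSpace_fin] at h
  omega

end Hyperplanes

/-! ### Critical points of the components of the momentum map. -/

section Momentum

variable {H : Type*} [NormedAddCommGroup H] [InnerProductSpace ℝ H] [CompleteSpace H]
  {M : Type*} [TopologicalSpace M] [ChartedSpace H M] [IsManifold 𝓘(ℝ, H) ∞ M]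
  {σ : StrongSymplecticForm H M} {n : ℕ} [AddAction (EuclideanSpace ℝ (Fin n)) M]
  {μ : M → EuclideanSpace ℝ (Fin n)}

theorem IsMomentumMap.hasMFDerivAt_inner (hμ : IsMomentumMap σ μ) (ξ : EuclideanSpace ℝ (Fin n))
    (x : M) : HasMFDerivAt 𝓘(ℝ, H) 𝓘(ℝ, ℝ) (fun y ↦ inner ℝ ξ (μ y)) x
      (innerSL ℝ ξ ∘L mvfderiv 𝓘(ℝ, H) μ x) := by
  have h1 := (hμ.smooth.mdifferentiableAt (x := x) (by simp)).hasMFDerivAt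
  have h2 : HasMFDerivAt 𝓘(ℝ, EuclideanSpace ℝ (Fin n)) 𝓘(ℝ, ℝ) (innerSL ℝ ξ) (μ x)
      (innerSL ℝ ξ) := (innerSL ℝ ξ).hasMFDerivAt
  exact h2.comp x h1

theorem IsMomentumMap.inner_mvfderiv (hμ : IsMomentumMap σ μ) (ξ : EuclideanSpace ℝ (Fin n))
    (x : M) (v : TangentSpace 𝓘(ℝ, H) x) :
    inner ℝ ξ (mvfderiv 𝓘(ℝ, H) μ x v) = σ.form x (generator H ξ x) v := by
  rw [← hμ.hamilton ξ x v]
  simp only [real_inner_comm ξ]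
  have h : mvfderiv 𝓘(ℝ, H) (fun y ↦ inner ℝ ξ (μ y)) x v =
      (innerSL ℝ ξ ∘L mvfderiv 𝓘(ℝ, H) μ x) v := by
    rw [mvfderiv, (hμ.hasMFDerivAt_inner ξ x).mfderiv]
    rfl
  exact h.symm

/-- The orbit of `x` under `ξ` is constant, so `ξ` generates the zero vector there and Hamilton's
equation kills the differential. -/
theorem IsMomentumMap.hasMFDerivAt_inner_eq_zero (hμ : IsMomentumMap σ μ)
    {ξ : EuclideanSpace ℝ (Fin n)} {x : M} (hξ : ξ ∈ stabilizerAlgebra n x) :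
    HasMFDerivAt 𝓘(ℝ, H) 𝓘(ℝ, ℝ) (fun y ↦ inner ℝ ξ (μ y)) x 0 := by
  have hgen : generator H ξ x = 0 := by
    have h : (fun t : ℝ ↦ (t • ξ) +ᵥ x) = fun _ ↦ x := funext hξ
    rw [generator, h, mfderiv_const]
    rfl
  have h0 : innerSL ℝ ξ ∘L mvfderiv 𝓘(ℝ, H) μ x = 0 := by
    ext v
    have := hμ.inner_mvfderiv ξ x v
    rw [hgen, map_zero] at this
    exact this
  exact (hμ.hasMFDerivAt_inner ξ x).congr_mfderiv h0

/-- At a point that is not regular, some nonzero element of `ℝⁿ` generates a vanishing vector. -/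
theorem IsMomentumMap.exists_generator_eq_zero (hμ : IsMomentumMap σ μ) {x : M}
    (hx : ¬ IsRegularPoint H μ x) :
    ∃ ξ : EuclideanSpace ℝ (Fin n), ξ ≠ 0 ∧ generator H ξ x = 0 := by
  let R : Submodule ℝ (EuclideanSpace ℝ (Fin n)) := (mvfderiv 𝓘(ℝ, H) μ x).range
  have hR : R ≠ ⊤ := fun h ↦ hx (LinearMap.range_eq_top.1 h)
  have hR' : Rᗮ ≠ ⊥ := fun h ↦ hR (Submodule.orthogonal_eq_bot_iff.1 h)
  obtain ⟨ξ, hξR, hξ⟩ := Submodule.exists_mem_ne_zero_of_ne_bot hR'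
  refine ⟨ξ, hξ, (σ.nondegenerate x).1 ?_⟩
  ext v
  have h1 : inner ℝ ξ (mvfderiv 𝓘(ℝ, H) μ x v) = 0 :=
    Submodule.inner_left_of_mem_orthogonal (K := R) ⟨v, rfl⟩ hξR
  rw [hμ.inner_mvfderiv] at h1
  simpa using h1

end Momentum

end AlmostPeriodic

end

theorem theorem5p4p1
    {H : Type*} [NormedAddCommGroup H] [InnerProductSpace ℝ H] [CompleteSpace H]
    [TopologicalSpace.SeparableSpace H]
    {M : Type*} [TopologicalSpace M] [ChartedSpace H M] [IsManifold 𝓘(ℝ, H) ∞ M]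
    [T2Space M] [ParacompactSpace M] [ConnectedSpace M]
    (σ : AlmostPeriodic.StrongSymplecticForm H M)
    {n : ℕ} [AddAction (EuclideanSpace ℝ (Fin n)) M]
    (hap : AlmostPeriodic.IsAlmostPeriodic H M n)
    (hfix : AlmostPeriodic.HasIsolatedFixedPoints M n)
    (μ : M → EuclideanSpace ℝ (Fin n)) (hμ : AlmostPeriodic.IsMomentumMap σ μ) :
    (∃ 𝒜 : Set (AffineSubspace ℝ (EuclideanSpace ℝ (Fin n))),
      𝒜.Countable ∧ (∀ A ∈ 𝒜, AlmostPeriodic.IsAffineHyperplane A) ∧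
      AlmostPeriodic.singularValues H μ ⊆ ⋃ A ∈ 𝒜, (A : Set (EuclideanSpace ℝ (Fin n)))) ∧
    AlmostPeriodic.regularValues H μ ∈ residual (EuclideanSpace ℝ (Fin n)) := by
  have : SecondCountableTopology H := UniformSpace.secondCountable_of_separable H
  have : SecondCountableTopology M := AlmostPeriodic.secondCountableTopology_of_paracompact H
  obtain ⟨N, _, a, hsm, ha⟩ := hap.exists_linear
  have hL : (range fun x : M ↦ AlmostPeriodic.stabilizerAlgebra n x).Countable :=
    AlmostPeriodic.countable_range_of_eventually_le
      (AlmostPeriodic.eventually_stabilizerAlgebra_le hsm ha)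
  -- One vector per algebra suffices: a singular point with algebra `L` is fixed by `ξ L`, whichever
  -- `η` witnessed its singularity. This leaves countably many vectors.
  choose! ξ hξmem hξne using fun (L : Submodule ℝ (EuclideanSpace ℝ (Fin n))) (hL : L ≠ ⊥) ↦
    Submodule.exists_mem_ne_zero_of_ne_bot hL
  let 𝓛 := (range fun x : M ↦ AlmostPeriodic.stabilizerAlgebra n x) ∩ {L | L ≠ ⊥}
  let 𝒜 : Set (AffineSubspace ℝ (EuclideanSpace ℝ (Fin n))) := ⋃ L ∈ 𝓛,
    AlmostPeriodic.levelHyperplane (ξ L) ''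
      ((fun y ↦ inner ℝ (ξ L) (μ y)) '' {y | ξ L ∈ AlmostPeriodic.stabilizerAlgebra n y})
  have hc : 𝒜.Countable := (hL.mono inter_subset_left).biUnion fun L _ ↦
    (AlmostPeriodic.countable_image_setOf_mem_stabilizerAlgebra hsm ha
      fun y hy ↦ hμ.hasMFDerivAt_inner_eq_zero hy).image _
  have hA : ∀ A ∈ 𝒜, AlmostPeriodic.IsAffineHyperplane A := by
    intro A hA
    obtain ⟨L, hL, c, -, rfl⟩ := mem_iUnion₂.1 hA
    exact AlmostPeriodic.isAffineHyperplane_levelHyperplane (hξne L hL.2) c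
  have hsub : AlmostPeriodic.singularValues H μ ⊆
      ⋃ A ∈ 𝒜, (A : Set (EuclideanSpace ℝ (Fin n))) := by
    rintro _ ⟨x, rfl, hx⟩
    obtain ⟨η, hη, hgen⟩ := hμ.exists_generator_eq_zero hx
    have hηx := AlmostPeriodic.mem_stabilizerAlgebra_of_generator_eq_zero hsm ha hgen
    set L := AlmostPeriodic.stabilizerAlgebra n x
    have hLne : L ≠ ⊥ := fun h ↦ hη ((Submodule.eq_bot_iff _).1 h η hηx)
    exact mem_biUnion (mem_biUnion (show L ∈ 𝓛 from ⟨⟨x, rfl⟩, hLne⟩)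
      ⟨_, ⟨x, hξmem L hLne, rfl⟩, rfl⟩)
      ((AlmostPeriodic.mem_levelHyperplane (hξne L hLne)).2 rfl)
  refine ⟨⟨𝒜, hc, hA, hsub⟩, ?_⟩
  refine mem_of_superset ((countable_bInter_mem hc).2 fun A h ↦ (hA A h).compl_mem_residual) ?_
  intro c hc' x hxc
  by_contra hx
  obtain ⟨A, hA', hcA⟩ := mem_iUnion₂.1 (hsub ⟨x, hxc, hx⟩)
  exact mem_iInter₂.1 hc' A hA' hcA
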